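/- Let $\Gamma$ be a weighted digraph without loops on the vertex set $\{1,\dots,n\}$, $n>1$, with arc weight matrix $W=(w_{ij})$, where $w_{ij}>0$ if there is an arc from $i$ to $j$ and $w_{ij}=0$ otherwise. Let $L=(l_{ij})$ be its column Laplacian: $l_{ij}=-w_{ij}$ for $j\ne i$ and $l_{ii}=-\sum_{k\ne i}l_{ki}$. A diverging tree is a weakly connected digraph in which one vertex, the root, has indegree $0$ and all other vertices have indegree $1$; the tree is said to diverge from its root. An out-forest of $\Gamma$ is a spanning subgraph of $\Gamma$ all of whose weak components are diverging trees, and an out-arborescence of a digraph is a spanning diverging tree of it. The weight $w(H)$ of a subgraph $H$ is the product of the weights of its arcs (equal to $1$ if there are none), and the weight $w(\mathcal G)$ of a finite set $\mathcal G$ of subgraphs is the sum of the weights of its elements. Let $d'$ be the out-forest dimension of $\Gamma$, i.e. the minimum number of trees in an out-forest of $\Gamma$. The stochastic matrix of maximum out-forests is $\tilde J=(\tilde J_{ij})$ with $\tilde J_{ij}=w(\mathcal F^{i\to j})/w(\mathcal F)$, where $\mathcal F$ is the set of all out-forests of $\Gamma$ with $n-d'$ arcs and $\mathcal F^{i\to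 j}$ is the set of those among them in which $j$ belongs to a tree diverging from $i$. A source knot of $\Gamma$ is the vertex set of a strong component of $\Gamma$ that no arc enters from another strong component. Then every column of $\tilde J$ is a solution of $$Lx=0.\qquad(*)$$ Moreover, the number of source knots is $d'$. Let $K_1,\dots,K_{d'}$ be the source knots, and suppose that the numbering of the vertices is standard: the smallest numbers are attached to the vertices in $K_1$, the following numbers to the vertices in $K_2$, etc., and the largest numbers to the vertices outside $K_1\cup\dots\cup K_{d'}$. Let $j_1\in K_1,\dots,j_{d'}\in K_{d'}$. Then the columns $\tilde J_{\bullet j_1},\dots,\tilde J_{\bullet j_{d'}}$ form an orthogonal basis of the space of solutions of $(*)$ in $\mathbb R^n$ and, for $s=1,\dots,d'$, $$\tilde J_{\bullet j_s}=\frac1{w(\mathcal T_s)}\bigl(0,\dots,0,\,w(\mathcal T_s^{i_s+1}),\dots,w(\mathcal T_s^{i_s+k_s}),\,0,\dots,0\bigr)^T,$$ where $\{i_s+1,\dots,i_s+k_s\}=K_s$, $\mathcal T_s$ is the set of out-arborescences of the restriction of $\Gamma$ to $K_s$ (whose weight is positive), and $\mathcal T_s^{i}$ is the set of those out-arborescences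 that diverge from $i$; the entry $w(\mathcal T_s^i)$ stands in position $i$. -/

import Mathlib

/-- A weighted digraph without loops on the vertex type `V`, given by its matrix of arc weights:
`w i j` is zero if there is no arc from `i` to `j`, and is strictly positive otherwise. -/
structure WeightedDigraph (V : Type*) where
  /-- the matrix of arc weights -/
  w : V → V → ℝ
  nonneg : ∀ i j, 0 ≤ w i j
  loopless : ∀ i, w i i = 0

namespace ArcSet

/-! A digraph with vertex set `V` is represented by its finite set of arcs; an arc `(u, v)` goes
from `u` to `v`. -/

variable {V : Type*}

open Classical in
/-- The number of arcs that come in `v`. -/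
noncomputable def indegree (F : Finset (V × V)) (v : V) : ℕ :=
  (F.filter (fun p => p.2 = v)).card

/-- `v` is reachable from `u`: `v = u` or there is a path from `u` to `v`. -/
def Reachable (F : Finset (V × V)) (u v : V) : Prop :=
  Relation.ReflTransGen (fun a b => (a, b) ∈ F) u v

/-- `u = v`, or `u` and `v` are connected by a semiwalk; the classes are the weak components. -/
def WeaklyConnected (F : Finset (V × V)) (u v : V) : Prop :=
  Relation.EqvGen (fun a b => (a, b) ∈ F) u v

/-- The weak component of `r` is a diverging tree with root `r`. All arcs at a vertex lie in the
weak component of this vertex, so indegrees may be computed in the whole digraph. -/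
def IsTreeComponent (F : Finset (V × V)) (r : V) : Prop :=
  indegree F r = 0 ∧ ∀ v, WeaklyConnected F r v → v ≠ r → indegree F v = 1

/-- The digraph with vertex set `V` and arc set `F` is a diverging tree that diverges from `r`. -/
def IsDivergingTree (F : Finset (V × V)) (r : V) : Prop :=
  (∀ u v, WeaklyConnected F u v) ∧ indegree F r = 0 ∧ ∀ v, v ≠ r → indegree F v = 1

/-- All weak components are diverging trees. -/
def IsDivergingForest (F : Finset (V × V)) : Prop :=
  ∀ v, ∃ r, WeaklyConnected F r v ∧ IsTreeComponent F r

/-- `j` belongs to a tree diverging from `i`, i.e. to a weak component that is a diverging tree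
with root `i`. -/
def InTreeFrom (F : Finset (V × V)) (i j : V) : Prop :=
  IsTreeComponent F i ∧ WeaklyConnected F i j

open Classical in
/-- The number of weak components that are diverging trees (each is counted through its root). -/
noncomputable def numTrees [Fintype V] (F : Finset (V × V)) : ℕ :=
  (Finset.univ.filter (fun r => IsTreeComponent F r)).card

end ArcSet

namespace WeightedDigraph

variable {V : Type*} [Fintype V] (Γ : WeightedDigraph V)

open Classical in
/-- The set of arcs of `Γ`. -/
noncomputable def arcs : Finset (V × V) :=
  Finset.univ.filter (fun p => 0 < Γ.w p.1 p.2)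

open Classical in
/-- The column Laplacian matrix: `l i j = - w i j` for `j ≠ i`, and
`l i i = - ∑ k ≠ i, l k i = ∑ k ≠ i, w k i`. -/
noncomputable def laplacian : Matrix V V ℝ := fun i j =>
  if i = j then ∑ k ∈ Finset.univ.filter (fun k => k ≠ i), Γ.w k i else - Γ.w i j

/-- The weight of a subgraph: the product of the weights of its arcs. -/
noncomputable def weight (F : Finset (V × V)) : ℝ := ∏ p ∈ F, Γ.w p.1 p.2

/-- The weight of a set of subgraphs: the sum of their weights. -/
noncomputable def setWeight (G : Finset (Finset (V × V))) : ℝ := ∑ F ∈ G, Γ.weight F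

open Classical in
/-- The out-forests of `Γ`, i.e. its spanning diverging forests. -/
noncomputable def outForests : Finset (Finset (V × V)) :=
  Γ.arcs.powerset.filter (fun F => ArcSet.IsDivergingForest F)

open Classical in
/-- The out-forests of `Γ` with `k` arcs. -/
noncomputable def outForestsCard (k : ℕ) : Finset (Finset (V × V)) :=
  Γ.outForests.filter (fun F => F.card = k)

open Classical in
/-- The out-forests of `Γ` with `k` arcs where `j` belongs to a tree diverging from `i`. -/
noncomputable def outForestsFromTo (k : ℕ) (i j : V) : Finset (Finset (V × V)) :=
  (Γ.outForestsCard k).filter (fun F => ArcSet.InTreeFrom F i j)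

/-- The total weight of the out-forests with `k` arcs. -/
noncomputable def sigma (k : ℕ) : ℝ := Γ.setWeight (Γ.outForestsCard k)

/-- The matrix of out-forests with `k` arcs. -/
noncomputable def Q (k : ℕ) : Matrix V V ℝ := fun i j => Γ.setWeight (Γ.outForestsFromTo k i j)

/-- The stochastic matrix of out-forests with `k` arcs. -/
noncomputable def J (k : ℕ) : Matrix V V ℝ := (Γ.sigma k)⁻¹ • Γ.Q k

/-- The out-forest dimension: the minimum possible number of diverging trees in an out-forest. -/
noncomputable def outForestDim : ℕ :=
  sInf {m | ∃ F ∈ Γ.outForests, ArcSet.numTrees F = m}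

/-- The stochastic matrix of maximum out-forests. -/
noncomputable def Jtilde : Matrix V V ℝ := Γ.J (Fintype.card V - Γ.outForestDim)

/-- `S` is the vertex set of a strong component of `Γ`, i.e. a class of mutually reachable
vertices. -/
def IsStrongComponent (S : Finset V) : Prop :=
  ∃ v, ∀ u, u ∈ S ↔ ArcSet.Reachable Γ.arcs u v ∧ ArcSet.Reachable Γ.arcs v u

/-- The arcs of the condensation of `Γ`. -/
def CondensationArc (S T : Finset V) : Prop :=
  S ≠ T ∧ ∃ u ∈ S, ∃ v ∈ T, (u, v) ∈ Γ.arcs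

/-- `S` is a source knot: the vertex set of a strong component that is a source of the
condensation. -/
def IsSourceKnot (S : Finset V) : Prop :=
  Γ.IsStrongComponent S ∧ ∀ T, Γ.IsStrongComponent T → ¬ Γ.CondensationArc T S

/-- `K 0, …, K (d - 1)` is a list of all source knots of `Γ` without repetitions. -/
def EnumeratesSourceKnots {d : ℕ} (K : Fin d → Finset V) : Prop :=
  Function.Injective K ∧ ∀ S, Γ.IsSourceKnot S ↔ ∃ s, K s = S

/-- The restriction of `Γ` to a set of vertices. -/
def restrict (S : Finset V) : WeightedDigraph {x // x ∈ S} where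
  w i j := Γ.w i j
  nonneg i j := Γ.nonneg i j
  loopless i := Γ.loopless i

open Classical in
/-- The out-arborescences (spanning diverging trees) of `Γ`. -/
noncomputable def arborescences : Finset (Finset (V × V)) :=
  Γ.arcs.powerset.filter (fun F => ∃ r, ArcSet.IsDivergingTree F r)

open Classical in
/-- The out-arborescences of `Γ` that diverge from `r`. -/
noncomputable def arborescencesFrom (r : V) : Finset (Finset (V × V)) :=
  Γ.arcs.powerset.filter (fun F => ArcSet.IsDivergingTree F r)

end WeightedDigraph

/-- The vertices are numbered so that the smallest numbers are attached to the vertices in the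
first set of the list `K`, the following numbers to the vertices in the second set, etc., and the
largest numbers to the vertices outside of all these sets. -/
def IsStandardNumbering {n d : ℕ} (K : Fin d → Finset (Fin n)) : Prop :=
  (∀ s t, s < t → ∀ u ∈ K s, ∀ v ∈ K t, u < v) ∧
    ∀ s, ∀ u ∈ K s, ∀ v, (∀ t, v ∉ K t) → u < v

/-!
A set of arcs is a diverging forest iff at most one arc comes in each vertex and every vertex is
reachable from a source, i.e. from a vertex that no arc comes in (`isDivergingForest_iff`). All
combinatorial arguments use this form; the sources are the roots of the trees.

*The columns solve the system.* Row `i` of `L Q = 0`, for the matrix `Q` of maximum out-forests,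
says that the arcs `(u, i)` together with the maximum forests where `j` belongs to the tree of `i`
weigh as much as the arcs `(i, m)` together with the maximum forests where `j` belongs to the tree
of `m`. Both sides count the same subgraphs: in a maximum forest, an arc that comes in a root
closes a cycle, since otherwise it would join two trees. So either sum runs over the subgraphs with
one cycle, which passes through `i` and from which `j` descends; the forest arises by deleting the
arc of the cycle that comes in `i`, or the one that leaves `i` (`exchange`,
`exists_insert_in_iff_exists_insert_out`, `laplacian_mulVec_Q`).

*The dimension.* A source knot contains all its ancestors, and every vertex descends from a source
knot. So each forest has a root in each source knot, and a forest grown from one chosen vertex in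
each of them has no further root (`EnumeratesSourceKnots.eq_outForestDim`). A solution of the
transposed system obeys a maximum principle: a vertex with the maximal value has ancestors of the
same value only. Hence it is determined by its values on one vertex of each source knot, and
the solution space has dimension at most `d'` (`EnumeratesSourceKnots.finrank_ker_le`). The column
of a vertex in a source knot is supported in this knot and has sum `1`, so `d'` such columns from
different knots are orthogonal and form a basis.

*The entries.* For the restriction of `Γ` to a source knot, the maximum out-forests are the
out-arborescences. So the vector of tree weights solves its system, and the extension by zero
solves the system of `Γ`. As a solution is determined by its sums over the source knots, the
normalized vector of tree weights is a column of the matrix of maximum out-forests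
(`EnumeratesSourceKnots.Jtilde_eq_arborescencesFrom`).
-/

/-! ### Diverging forests through in-arcs and reachability -/

namespace ArcSet

variable {V : Type*} {F : Finset (V × V)}

/-- No arc comes in `r`. -/
def IsSource (F : Finset (V × V)) (r : V) : Prop := ∀ a, (a, r) ∉ F

/-- At most one arc comes in each vertex. -/
def InUnique (F : Finset (V × V)) : Prop := ∀ ⦃a b v⦄, (a, v) ∈ F → (b, v) ∈ F → a = b

theorem indegree_eq_zero_iff {v : V} : indegree F v = 0 ↔ IsSource F v := by
  classical
  simp only [indegree, Finset.card_eq_zero, Finset.filter_eq_empty_iff, IsSource]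
  exact ⟨fun h a ha => h ha rfl, fun h p hp hv => h p.1 (by rw [← hv]; exact hp)⟩

theorem inUnique_iff_indegree_le_one : InUnique F ↔ ∀ v, indegree F v ≤ 1 := by
  classical
  simp only [indegree, Finset.card_le_one, Finset.mem_filter]
  constructor
  · rintro h v ⟨a, _⟩ ⟨ha, rfl⟩ ⟨b, _⟩ ⟨hb, rfl⟩
    rw [h ha hb]
  · intro h a b v ha hb
    exact congrArg Prod.fst (h v (a, v) ⟨ha, rfl⟩ (b, v) ⟨hb, rfl⟩)

theorem Reachable.weaklyConnected {u v : V} (h : Reachable F u v) : WeaklyConnected F u v := by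
  induction h with
  | refl => exact .refl _
  | tail _ h ih => exact .trans _ _ _ ih (.rel _ _ h)

theorem Reachable.mono {G : Finset (V × V)} (hFG : F ⊆ G) {u v : V} (h : Reachable F u v) :
    Reachable G u v :=
  Relation.ReflTransGen.mono (fun _ _ hab => hFG hab) _ _ h

/-- An arc `(a, b)` is the last arc of every path from the source `r` to `b`. -/
theorem Reachable.of_arc (hF : InUnique F) {r a b : V} (hr : IsSource F r)
    (hb : Reachable F r b) (hab : (a, b) ∈ F) : Reachable F r a := by
  rcases Relation.ReflTransGen.cases_tail hb with rfl | ⟨c, hc, hcb⟩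
  · exact absurd hab (hr a)
  · rwa [hF hab hcb]

theorem Reachable.eq_of_isSource {r v : V} (h : Reachable F r v) (hv : IsSource F v) : r = v := by
  rcases Relation.ReflTransGen.cases_tail h with h | ⟨c, _, hc⟩
  · exact h.symm
  · exact absurd hc (hv c)

/-- A vertex is reachable from one source at most. -/
theorem isSource_unique (hF : InUnique F) {r s v : V} (hr : IsSource F r) (hs : IsSource F s)
    (hrv : Reachable F r v) (hsv : Reachable F s v) : r = s := by
  induction hsv with
  | refl => exact hrv.eq_of_isSource hs
  | tail _ h ih => exact ih (hrv.of_arc hF hr h)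

/-- The set of vertices reachable from a source is closed under stepping back along arcs, so it
is a whole weak component. -/
theorem WeaklyConnected.reachable (hF : InUnique F) {r v : V} (hr : IsSource F r)
    (h : WeaklyConnected F r v) : Reachable F r v := by
  have key : ∀ u v, WeaklyConnected F u v → (Reachable F r u ↔ Reachable F r v) := by
    intro u v h
    induction h with
    | rel a b hab => exact ⟨fun h => h.tail hab, fun h => h.of_arc hF hr hab⟩
    | refl => rfl
    | symm _ _ _ ih => exact ih.symm
    | trans _ _ _ _ _ ih₁ ih₂ => exact ih₁.trans ih₂
  exact (key r v h).1 .refl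

theorem isTreeComponent_iff (hF : InUnique F) {r : V} : IsTreeComponent F r ↔ IsSource F r := by
  refine ⟨fun h => indegree_eq_zero_iff.1 h.1, fun h => ⟨indegree_eq_zero_iff.2 h, ?_⟩⟩
  intro v hv hne
  have h0 : indegree F v ≠ 0 := fun h0 =>
    hne ((hv.reachable hF h).eq_of_isSource (indegree_eq_zero_iff.1 h0)).symm
  have h1 := inUnique_iff_indegree_le_one.1 hF v
  omega

theorem inTreeFrom_iff (hF : InUnique F) {i j : V} :
    InTreeFrom F i j ↔ IsSource F i ∧ Reachable F i j := by
  rw [InTreeFrom, isTreeComponent_iff hF]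
  exact and_congr_right fun h => ⟨fun hc => hc.reachable hF h, fun hr => hr.weaklyConnected⟩

theorem isDivergingForest_iff : IsDivergingForest F ↔
    InUnique F ∧ ∀ v, ∃ r, IsSource F r ∧ Reachable F r v := by
  constructor
  · intro h
    have hF : InUnique F := by
      refine inUnique_iff_indegree_le_one.2 fun v => ?_
      obtain ⟨r, hrv, h0, h1⟩ := h v
      by_cases hv : v = r
      · simp [hv, h0]
      · exact (h1 v hrv hv).le
    refine ⟨hF, fun v => ?_⟩
    obtain ⟨r, hrv, hr⟩ := h v
    have hs := (isTreeComponent_iff hF).1 hr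
    exact ⟨r, hs, hrv.reachable hF hs⟩
  · rintro ⟨hF, h⟩ v
    obtain ⟨r, hs, hr⟩ := h v
    exact ⟨r, hr.weaklyConnected, (isTreeComponent_iff hF).2 hs⟩

theorem isDivergingTree_iff {r : V} : IsDivergingTree F r ↔
    InUnique F ∧ IsSource F r ∧ ∀ v, Reachable F r v := by
  constructor
  · rintro ⟨hc, h0, h1⟩
    have hF : InUnique F := by
      refine inUnique_iff_indegree_le_one.2 fun v => ?_
      by_cases hv : v = r
      · simp [hv, h0]
      · exact (h1 v hv).le
    have hs := indegree_eq_zero_iff.1 h0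
    exact ⟨hF, hs, fun v => (hc r v).reachable hF hs⟩
  · rintro ⟨hF, hs, hr⟩
    have ht := (isTreeComponent_iff hF).2 hs
    exact ⟨fun u v => .trans _ _ _ (.symm _ _ (hr u).weaklyConnected) (hr v).weaklyConnected,
      ht.1, fun v hv => ht.2 v (hr v).weaklyConnected hv⟩

/-- Counting the arcs of a forest by their heads: all vertices but the roots have one each. -/
theorem card_add_numTrees [Fintype V] (hF : InUnique F) :
    F.card + numTrees F = Fintype.card V := by
  classical
  have h1 : F.card = ∑ v, indegree F v := by
    rw [Finset.card_eq_sum_card_fiberwise (f := Prod.snd) (t := Finset.univ) (by simp)]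
    refine Finset.sum_congr rfl fun v _ => ?_
    simp only [indegree]
  have h2 : numTrees F = ∑ v, if IsSource F v then 1 else 0 := by
    simp only [numTrees, isTreeComponent_iff hF, Finset.card_filter]
  rw [h1, h2, ← Finset.sum_add_distrib, Fintype.card_eq_sum_ones]
  refine Finset.sum_congr rfl fun v _ => ?_
  have h3 := inUnique_iff_indegree_le_one.1 hF v
  by_cases h : IsSource F v
  · simp [h, indegree_eq_zero_iff.2 h]
  · have : indegree F v ≠ 0 := mt indegree_eq_zero_iff.1 h
    simp only [h, if_false]
    omega

open Classical in
theorem numTrees_eq_card_isSource [Fintype V] (hF : InUnique F) :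
    numTrees F = (Finset.univ.filter (fun r => IsSource F r)).card := by
  simp only [numTrees, isTreeComponent_iff hF]

/-! ### Exchange of arcs and growth of forests -/

/-- A path to `b` may be cut at its first arrival in `b`. -/
theorem Reachable.avoid_out [DecidableEq V] {a b : V} (h : Reachable F a b) :
    Reachable (F.filter (fun p => p.1 ≠ b)) a b := by
  induction h using Relation.ReflTransGen.head_induction_on with
  | refl => exact .refl
  | @head a c hac _ ih =>
    by_cases hab : a = b
    · rw [hab]; exact .refl
    · exact .head (Finset.mem_filter.2 ⟨hac, hab⟩) ih

/-- A path from `a` may be started at its last departure from `a`. -/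
theorem Reachable.avoid_in [DecidableEq V] {a b : V} (h : Reachable F a b) :
    Reachable (F.filter (fun p => p.2 ≠ a)) a b := by
  induction h with
  | refl => exact .refl
  | @tail c d _ hcd ih =>
    by_cases hd : d = a
    · rw [hd]; exact .refl
    · exact ih.tail (Finset.mem_filter.2 ⟨hcd, hd⟩)

theorem InUnique.mono {G : Finset (V × V)} (hG : InUnique G) (hFG : F ⊆ G) : InUnique F :=
  fun _ _ _ ha hb => hG (hFG ha) (hFG hb)

theorem InUnique.insert [DecidableEq V] (hF : InUnique F) {u i : V} (hi : IsSource F i) :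
    InUnique (insert (u, i) F) := by
  intro a b v ha hb
  rw [Finset.mem_insert, Prod.mk.injEq] at ha hb
  rcases ha with ⟨rfl, rfl⟩ | ha <;> rcases hb with ⟨rfl, h⟩ | hb
  · rfl
  · exact absurd hb (hi b)
  · exact absurd (h ▸ ha) (hi a)
  · exact hF ha hb

/-- The arc added at the root of a forest can be recovered if its head is given. -/
theorem insert_in_injective [DecidableEq V] {i u u' : V} {F' : Finset (V × V)}
    (hF : IsSource F i) (hF' : IsSource F' i) (h : insert (u, i) F = insert (u', i) F') :
    u = u' ∧ F = F' := by
  have hu : u = u' := by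
    have := Finset.mem_insert_self (u, i) F
    rw [h, Finset.mem_insert, Prod.mk.injEq] at this
    exact (this.resolve_right (hF' u)).1
  subst hu
  refine ⟨rfl, ?_⟩
  rw [← Finset.erase_insert (hF u), h, Finset.erase_insert (hF' u)]

/-- An arc that comes in a root `i` from another tree joins two trees of a forest. -/
theorem isDivergingForest_insert [DecidableEq V] (hF : IsDivergingForest F) {u i : V}
    (hi : IsSource F i) (hu : ¬ Reachable F i u) : IsDivergingForest (insert (u, i) F) := by
  rw [isDivergingForest_iff] at hF ⊢
  obtain ⟨hU, hR⟩ := hF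
  have hsub : F ⊆ insert (u, i) F := Finset.subset_insert _ _
  have hsrc : ∀ r, IsSource F r → r ≠ i → IsSource (insert (u, i) F) r := by
    intro r hr hne a ha
    rw [Finset.mem_insert, Prod.mk.injEq] at ha
    rcases ha with ⟨_, h⟩ | ha
    · exact hne h
    · exact hr a ha
  refine ⟨hU.insert hi, fun v => ?_⟩
  obtain ⟨r, hr, hrv⟩ := hR v
  by_cases hri : r = i
  · obtain ⟨s, hs, hsu⟩ := hR u
    refine ⟨s, hsrc s hs (fun h => hu (h ▸ hsu)), ?_⟩
    exact ((hsu.mono hsub).tail (Finset.mem_insert_self _ _)).trans (hri ▸ hrv.mono hsub)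
  · exact ⟨r, hsrc r hr hri, hrv.mono hsub⟩

/-- Exchange: an arc `(u, i)` from the tree with root `i` to its root closes a cycle; deleting
an arc `(a, b)` of this cycle gives a forest where this tree is replaced by a tree with root `b`
on the same vertices. -/
theorem exchange [DecidableEq V] (hF : IsDivergingForest F) {u i a b : V} (hi : IsSource F i)
    (hia : Reachable F i a) (hab : (a, b) ∈ F) (hbu : Reachable F b u) :
    IsDivergingForest ((insert (u, i) F).erase (a, b)) ∧
      IsSource ((insert (u, i) F).erase (a, b)) b ∧
      ∀ v, Reachable F i v → Reachable ((insert (u, i) F).erase (a, b)) b v := by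
  rw [isDivergingForest_iff] at hF ⊢
  obtain ⟨hU, hR⟩ := hF
  set G := (insert (u, i) F).erase (a, b) with hG
  have hbi : b ≠ i := fun h => hi a (h ▸ hab)
  have hmem : ∀ p ∈ F, p ≠ (a, b) → p ∈ G := fun p hp hne =>
    Finset.mem_erase.2 ⟨hne, Finset.mem_insert_of_mem hp⟩
  have hui : (u, i) ∈ G :=
    Finset.mem_erase.2 ⟨fun h => hbi (congrArg Prod.snd h).symm, Finset.mem_insert_self _ _⟩
  have hb : IsSource G b := by
    intro c hc
    rw [hG, Finset.mem_erase, Finset.mem_insert, Prod.mk.injEq, Ne, Prod.mk.injEq] at hc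
    obtain ⟨hne, ⟨_, h⟩ | hc⟩ := hc
    · exact hbi h
    · exact hne ⟨hU hc hab, rfl⟩
  have hsrc : ∀ r, IsSource F r → r ≠ i → IsSource G r := by
    intro r hr hne c hc
    rw [hG, Finset.mem_erase, Finset.mem_insert, Prod.mk.injEq] at hc
    obtain ⟨_, ⟨_, h⟩ | hc⟩ := hc
    · exact hne h
    · exact hr c hc
  have hbu' : Reachable G b u := hbu.avoid_in.mono fun p hp => by
    rw [Finset.mem_filter] at hp
    exact hmem p hp.1 fun h => hp.2 (congrArg Prod.snd h)
  have htree : ∀ v, Reachable F i v → Reachable G b v := by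
    intro v hv
    induction hv with
    | refl => exact hbu'.tail hui
    | @tail c d _ hcd ih =>
      by_cases h : (c, d) = (a, b)
      · rw [(Prod.mk.inj h).2]; exact .refl
      · exact ih.tail (hmem _ hcd h)
  refine ⟨⟨(hU.insert hi).mono (Finset.erase_subset _ _), fun v => ?_⟩, hb, htree⟩
  obtain ⟨r, hr, hrv⟩ := hR v
  by_cases hri : r = i
  · exact ⟨b, hb, htree v (hri ▸ hrv)⟩
  · refine ⟨r, hsrc r hr hri, ?_⟩
    -- a path from another root never meets `a`
    induction hrv with
    | refl => exact .refl
    | @tail c d hc hcd ih =>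
      refine ih.tail (hmem _ hcd fun h => hri ?_)
      exact isSource_unique hU hr hi ((Prod.mk.inj h).1 ▸ hc) hia

/-- If every vertex is reachable from `R`, then there is a spanning forest with set of roots `R`:
a maximal union of trees that grow from `R` spans. -/
theorem exists_inUnique_of_reachable [Finite V] (E : Finset (V × V)) (R : Set V)
    (hR : ∀ v, ∃ r ∈ R, Reachable E r v) :
    ∃ F ⊆ E, InUnique F ∧ (∀ r, IsSource F r ↔ r ∈ R) ∧ ∀ v, ∃ r ∈ R, Reachable F r v := by
  classical
  let P : Finset (V × V) → Prop := fun F => InUnique F ∧ (∀ r ∈ R, IsSource F r) ∧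
    ∀ a v, (a, v) ∈ F → ∃ r ∈ R, Reachable F r v
  have hP : (E.powerset.filter P).Nonempty :=
    ⟨∅, Finset.mem_filter.2 ⟨by simp, by simp [P, InUnique, IsSource]⟩⟩
  obtain ⟨F, hF, hmax⟩ := Finset.exists_max_image _ Finset.card hP
  rw [Finset.mem_filter, Finset.mem_powerset] at hF
  obtain ⟨hFE, hU, hs, hr⟩ := hF
  have hcov : ∀ v, ∃ r ∈ R, Reachable F r v := by
    intro v
    obtain ⟨r, hrR, hrv⟩ := hR v
    induction hrv with
    | refl => exact ⟨r, hrR, .refl⟩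
    | @tail c d _ hcd ih =>
      by_contra hd
      obtain ⟨s, hsR, hsc⟩ := ih
      have hsd : IsSource F d := fun a ha => hd (hr a d ha)
      have hdR : d ∉ R := fun h => hd ⟨d, h, .refl⟩
      have hsub : F ⊆ insert (c, d) F := Finset.subset_insert _ _
      have hnew : insert (c, d) F ∈ E.powerset.filter P := by
        rw [Finset.mem_filter, Finset.mem_powerset]
        refine ⟨Finset.insert_subset hcd hFE, hU.insert hsd, ?_, ?_⟩
        · intro q hq a ha
          rw [Finset.mem_insert, Prod.mk.injEq] at ha
          rcases ha with ⟨_, h⟩ | ha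
          · exact hdR (h ▸ hq)
          · exact hs q hq a ha
        · intro a v ha
          rw [Finset.mem_insert, Prod.mk.injEq] at ha
          rcases ha with ⟨_, rfl⟩ | ha
          · exact ⟨s, hsR, (hsc.mono hsub).tail (Finset.mem_insert_self _ _)⟩
          · obtain ⟨q, hq, hqv⟩ := hr a v ha
            exact ⟨q, hq, hqv.mono hsub⟩
      have := hmax _ hnew
      rw [Finset.card_insert_of_notMem (hsd c)] at this
      omega
  refine ⟨F, hFE, hU, fun r => ⟨fun h => ?_, hs r⟩, hcov⟩
  obtain ⟨s, hsR, hsr⟩ := hcov r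
  rwa [← hsr.eq_of_isSource h]

end ArcSet

namespace WeightedDigraph

open ArcSet

/-! ### Maximum out-forests and the kernel of the Laplacian -/

section Forests

variable {V : Type*} [Fintype V] (Γ : WeightedDigraph V)

theorem mem_arcs {u v : V} : (u, v) ∈ Γ.arcs ↔ 0 < Γ.w u v := by simp [arcs]

theorem w_eq_zero_of_notMem {u v : V} (h : (u, v) ∉ Γ.arcs) : Γ.w u v = 0 :=
  le_antisymm (not_lt.1 (mt Γ.mem_arcs.2 h)) (Γ.nonneg u v)

theorem ne_of_mem_arcs {u v : V} (h : (u, v) ∈ Γ.arcs) : u ≠ v := by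
  rintro rfl
  exact (Γ.mem_arcs.1 h).ne' (Γ.loopless u)

theorem mem_outForestsCard {k : ℕ} {F : Finset (V × V)} :
    F ∈ Γ.outForestsCard k ↔ F ⊆ Γ.arcs ∧ IsDivergingForest F ∧ F.card = k := by
  simp [outForestsCard, outForests, and_assoc]

theorem mem_outForestsFromTo {k : ℕ} {i j : V} {F : Finset (V × V)} :
    F ∈ Γ.outForestsFromTo k i j ↔
      F ∈ Γ.outForestsCard k ∧ IsSource F i ∧ Reachable F i j := by
  simp only [outForestsFromTo, Finset.mem_filter]
  refine and_congr_right fun h => inTreeFrom_iff ?_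
  exact (isDivergingForest_iff.1 (Γ.mem_outForestsCard.1 h).2.1).1

theorem weight_pos {F : Finset (V × V)} (hF : F ⊆ Γ.arcs) : 0 < Γ.weight F :=
  Finset.prod_pos fun _ hp => Γ.mem_arcs.1 (hF hp)

theorem setWeight_pos {G : Finset (Finset (V × V))} (hG : G.Nonempty)
    (h : ∀ F ∈ G, F ⊆ Γ.arcs) : 0 < Γ.setWeight G :=
  Finset.sum_pos (fun F hF => Γ.weight_pos (h F hF)) hG

/-- In each forest, `j` belongs to exactly one tree. -/
theorem sum_Q (k : ℕ) (j : V) : ∑ i, Γ.Q k i j = Γ.sigma k := by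
  classical
  have h : Γ.outForestsCard k = Finset.univ.biUnion fun i => Γ.outForestsFromTo k i j := by
    ext F
    simp only [Finset.mem_biUnion, Finset.mem_univ, true_and, mem_outForestsFromTo]
    refine ⟨fun hF => ?_, fun ⟨_, hF, _⟩ => hF⟩
    obtain ⟨r, hr⟩ := (isDivergingForest_iff.1 (Γ.mem_outForestsCard.1 hF).2.1).2 j
    exact ⟨r, hF, hr⟩
  simp only [Q, sigma, setWeight]
  rw [h, Finset.sum_biUnion]
  intro i _ i' _ hne
  refine Finset.disjoint_left.2 fun F hF hF' => hne ?_
  rw [mem_outForestsFromTo] at hF hF'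
  exact isSource_unique (isDivergingForest_iff.1 (Γ.mem_outForestsCard.1 hF.1).2.1).1
    hF.2.1 hF'.2.1 hF.2.2 hF'.2.2

theorem laplacian_apply [DecidableEq V] (i j : V) :
    Γ.laplacian i j = (if i = j then ∑ k, Γ.w k i else 0) - Γ.w i j := by
  by_cases hij : i = j
  · subst hij
    simp only [laplacian, if_true, Γ.loopless, sub_zero]
    rw [Finset.sum_filter]
    refine Finset.sum_congr rfl fun k _ => ?_
    by_cases hk : k = i <;> simp [hk, Γ.loopless]
  · simp [laplacian, hij]

theorem laplacian_mulVec (x : V → ℝ) (i : V) :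
    Matrix.mulVec Γ.laplacian x i = (∑ k, Γ.w k i) * x i - ∑ k, Γ.w i k * x k := by
  classical
  simp [Matrix.mulVec, dotProduct, laplacian_apply, sub_mul, Finset.sum_sub_distrib]

theorem laplacian_transpose_mulVec (y : V → ℝ) (i : V) :
    Matrix.mulVec Γ.laplacian.transpose y i = ∑ k, Γ.w k i * (y i - y k) := by
  classical
  simp [Matrix.mulVec, dotProduct, laplacian_apply, sub_mul, mul_sub, Finset.sum_sub_distrib,
    Finset.sum_mul]

variable {Γ} {k : ℕ}

/-- In a forest with the maximal number of arcs, all arcs of `Γ` that come in a root start in the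
tree of this root. -/
theorem reachable_of_card_maximal (hk : ∀ F ∈ Γ.outForests, F.card ≤ k) {F : Finset (V × V)}
    (hF : F ∈ Γ.outForestsCard k) {u i : V} (hi : IsSource F i) (hu : (u, i) ∈ Γ.arcs) :
    Reachable F i u := by
  classical
  by_contra h
  obtain ⟨hs, hf, hc⟩ := Γ.mem_outForestsCard.1 hF
  have := hk (insert (u, i) F) (by
    simp only [outForests, Finset.mem_filter, Finset.mem_powerset]
    exact ⟨Finset.insert_subset hu hs, isDivergingForest_insert hf hi h⟩)
  rw [Finset.card_insert_of_notMem (hi u)] at this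
  omega

theorem exchange_mem [DecidableEq V] {F : Finset (V × V)} {u i a b j : V} (hF : F ∈ Γ.outForestsFromTo k i j)
    (hu : (u, i) ∈ Γ.arcs) (hia : Reachable F i a) (hab : (a, b) ∈ F) (hbu : Reachable F b u) :
    (insert (u, i) F).erase (a, b) ∈ Γ.outForestsFromTo k b j := by
  rw [mem_outForestsFromTo, mem_outForestsCard] at hF ⊢
  obtain ⟨⟨hs, hf, hc⟩, hi, hj⟩ := hF
  obtain ⟨h1, h2, h3⟩ := exchange hf hi hia hab hbu
  refine ⟨⟨?_, h1, ?_⟩, h2, h3 j hj⟩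
  · exact (Finset.erase_subset _ _).trans (Finset.insert_subset hu hs)
  · rw [Finset.card_erase_of_mem (Finset.mem_insert_of_mem hab),
      Finset.card_insert_of_notMem (hi u), hc, Nat.add_sub_cancel]

/-- The subgraphs with exactly one cycle, which passes through `i` and from which `j` descends,
arise in two ways: a new arc comes in the root `i` of the tree of `j` in a maximum forest, or a new
arc leaves `i` and comes in the root `m` of the tree of `j`. -/
theorem exists_insert_in_iff_exists_insert_out (hk : ∀ F ∈ Γ.outForests, F.card ≤ k)
    [DecidableEq V] (i j : V) (G : Finset (V × V)) :
    (∃ u, (u, i) ∈ Γ.arcs ∧ ∃ F ∈ Γ.outForestsFromTo k i j, insert (u, i) F = G) ↔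
      ∃ m, (i, m) ∈ Γ.arcs ∧ ∃ F ∈ Γ.outForestsFromTo k m j, insert (i, m) F = G := by
  constructor
  · rintro ⟨u, hu, F, hF, rfl⟩
    obtain ⟨hFk, hi, hj⟩ := Γ.mem_outForestsFromTo.1 hF
    have hiu := reachable_of_card_maximal hk hFk hi hu
    rcases Relation.ReflTransGen.cases_head hiu with h | ⟨m, him, hmu⟩
    · exact absurd h.symm (Γ.ne_of_mem_arcs hu)
    · refine ⟨m, (Γ.mem_outForestsCard.1 hFk).1 him, _,
        exchange_mem hF hu .refl him hmu, ?_⟩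
      rw [Finset.insert_erase (Finset.mem_insert_of_mem him)]
  · rintro ⟨m, hm, F, hF, rfl⟩
    obtain ⟨hFk, hs, hj⟩ := Γ.mem_outForestsFromTo.1 hF
    have hmi := reachable_of_card_maximal hk hFk hs hm
    rcases Relation.ReflTransGen.cases_tail hmi with h | ⟨u, hmu, hui⟩
    · exact absurd h (Γ.ne_of_mem_arcs hm)
    · refine ⟨u, (Γ.mem_outForestsCard.1 hFk).1 hui, _,
        exchange_mem hF hm hmu hui .refl, ?_⟩
      rw [Finset.insert_erase (Finset.mem_insert_of_mem hui)]

/-- The arc added at the root of a maximum forest can be recovered if its tail is given: it lies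
on the only cycle. -/
theorem insert_out_injective (hk : ∀ F ∈ Γ.outForests, F.card ≤ k) [DecidableEq V]
    {i m m' : V} {F F' : Finset (V × V)} (hF : F ∈ Γ.outForestsCard k)
    (hF' : F' ∈ Γ.outForestsCard k) (hm : IsSource F m) (hm' : IsSource F' m')
    (him : (i, m) ∈ Γ.arcs) (him' : (i, m') ∈ Γ.arcs)
    (h : insert (i, m) F = insert (i, m') F') : m = m' ∧ F = F' := by
  have hmm : m = m' := by
    -- without the arcs that leave `i`, both `m` and `m'` are sources and reach `i`
    have hfil : F.filter (fun p => p.1 ≠ i) = F'.filter (fun p => p.1 ≠ i) := by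
      have := congrArg (Finset.filter (fun p => p.1 ≠ i)) h
      simpa [Finset.filter_insert] using this
    have h1 := (reachable_of_card_maximal hk hF hm him).avoid_out
    have h2 := (reachable_of_card_maximal hk hF' hm' him').avoid_out
    rw [← hfil] at h2
    refine isSource_unique ((isDivergingForest_iff.1
      (Γ.mem_outForestsCard.1 hF).2.1).1.mono (Finset.filter_subset _ _)) ?_ ?_ h1 h2
    · exact fun a ha => hm a (Finset.filter_subset _ _ ha)
    · rw [hfil]
      exact fun a ha => hm' a (Finset.filter_subset _ _ ha)
  subst hmm
  refine ⟨rfl, ?_⟩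
  rw [← Finset.erase_insert (hm i), h, Finset.erase_insert (hm' i)]

/-- If no out-forest has more than `k` arcs, the columns of the matrix of out-forests with `k` arcs
are in the kernel of the Laplacian. -/
theorem laplacian_mulVec_Q (hk : ∀ F ∈ Γ.outForests, F.card ≤ k) (j : V) :
    Matrix.mulVec Γ.laplacian (fun i => Γ.Q k i j) = 0 := by
  classical
  funext i
  rw [laplacian_mulVec, Pi.zero_apply, sub_eq_zero]
  let A : Finset (Σ _ : V, Finset (V × V)) :=
    (Finset.univ.filter (fun u => (u, i) ∈ Γ.arcs)).sigma fun _ => Γ.outForestsFromTo k i j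
  let B : Finset (Σ _ : V, Finset (V × V)) :=
    (Finset.univ.filter (fun m => (i, m) ∈ Γ.arcs)).sigma fun m => Γ.outForestsFromTo k m j
  let α : (Σ _ : V, Finset (V × V)) → Finset (V × V) := fun p => insert (p.1, i) p.2
  let β : (Σ _ : V, Finset (V × V)) → Finset (V × V) := fun p => insert (i, p.1) p.2
  have hA : (∑ u, Γ.w u i) * Γ.Q k i j = ∑ p ∈ A, Γ.weight (α p) := by
    rw [Finset.sum_sigma, Finset.sum_mul, Finset.sum_filter]
    refine Finset.sum_congr rfl fun u _ => ?_
    split_ifs with hu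
    · rw [Q, setWeight, Finset.mul_sum]
      refine Finset.sum_congr rfl fun F hF => ?_
      rw [weight, weight, Finset.prod_insert ((Γ.mem_outForestsFromTo.1 hF).2.1 u)]
    · rw [Γ.w_eq_zero_of_notMem hu, zero_mul]
  have hB : ∑ m, Γ.w i m * Γ.Q k m j = ∑ p ∈ B, Γ.weight (β p) := by
    rw [Finset.sum_sigma, Finset.sum_filter]
    refine Finset.sum_congr rfl fun m _ => ?_
    split_ifs with hm
    · rw [Q, setWeight, Finset.mul_sum]
      refine Finset.sum_congr rfl fun F hF => ?_
      rw [weight, weight, Finset.prod_insert ((Γ.mem_outForestsFromTo.1 hF).2.1 i)]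
    · rw [Γ.w_eq_zero_of_notMem hm, zero_mul]
  have hαinj : Set.InjOn α A := by
    rintro ⟨u, F⟩ hp ⟨u', F'⟩ hp' h
    simp only [A, Finset.coe_sigma, Set.mem_sigma_iff, Finset.mem_coe, mem_outForestsFromTo]
      at hp hp'
    obtain ⟨rfl, rfl⟩ := insert_in_injective hp.2.2.1 hp'.2.2.1 h
    rfl
  have hβinj : Set.InjOn β B := by
    rintro ⟨m, F⟩ hp ⟨m', F'⟩ hp' h
    simp only [B, Finset.coe_sigma, Set.mem_sigma_iff, Finset.mem_coe, mem_outForestsFromTo,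
      Finset.mem_filter, Finset.mem_univ, true_and] at hp hp'
    obtain ⟨rfl, rfl⟩ := insert_out_injective hk hp.2.1 hp'.2.1 hp.2.2.1 hp'.2.2.1 hp.1 hp'.1 h
    rfl
  rw [hA, hB, ← Finset.sum_image (f := Γ.weight) hαinj, ← Finset.sum_image (f := Γ.weight) hβinj]
  congr 1
  ext G
  have := exists_insert_in_iff_exists_insert_out hk i j G
  simpa [A, B, α, β, and_assoc] using this

end Forests

/-! ### Source knots and the dimension of the kernel -/

section Knots

variable {V : Type*} [Fintype V] {Γ : WeightedDigraph V}

theorem exists_isStrongComponent_mem (Γ : WeightedDigraph V) (v : V) :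
    ∃ S, Γ.IsStrongComponent S ∧ v ∈ S := by
  classical
  refine ⟨Finset.univ.filter fun u => Reachable Γ.arcs u v ∧ Reachable Γ.arcs v u,
    ⟨v, by simp⟩, ?_⟩
  simp only [Finset.mem_filter, Finset.mem_univ, true_and]
  exact ⟨.refl, .refl⟩

theorem IsStrongComponent.reachable {S : Finset V} (hS : Γ.IsStrongComponent S) {u v : V}
    (hu : u ∈ S) (hv : v ∈ S) : Reachable Γ.arcs u v := by
  obtain ⟨x, hx⟩ := hS
  exact ((hx u).1 hu).1.trans ((hx v).1 hv).2

theorem IsStrongComponent.mem {S : Finset V} (hS : Γ.IsStrongComponent S) {u v : V}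
    (hv : v ∈ S) (huv : Reachable Γ.arcs u v) (hvu : Reachable Γ.arcs v u) : u ∈ S := by
  obtain ⟨x, hx⟩ := hS
  exact (hx u).2 ⟨huv.trans ((hx v).1 hv).1, ((hx v).1 hv).2.trans hvu⟩

theorem IsStrongComponent.nonempty {S : Finset V} (hS : Γ.IsStrongComponent S) : S.Nonempty := by
  obtain ⟨x, hx⟩ := hS
  exact ⟨x, (hx x).2 ⟨.refl, .refl⟩⟩

theorem IsStrongComponent.eq {S T : Finset V} (hS : Γ.IsStrongComponent S)
    (hT : Γ.IsStrongComponent T) {v : V} (hvS : v ∈ S) (hvT : v ∈ T) : S = T := by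
  ext u
  exact ⟨fun hu => hT.mem hvT (hS.reachable hu hvS) (hS.reachable hvS hu),
    fun hu => hS.mem hvS (hT.reachable hu hvT) (hT.reachable hvT hu)⟩

theorem IsSourceKnot.mem_of_arc {S : Finset V} (hS : Γ.IsSourceKnot S) {u v : V} (hv : v ∈ S)
    (h : (u, v) ∈ Γ.arcs) : u ∈ S := by
  obtain ⟨T, hT, hu⟩ := Γ.exists_isStrongComponent_mem u
  by_cases hTS : T = S
  · rwa [← hTS]
  · exact absurd ⟨hTS, u, hu, v, hv, h⟩ (hS.2 T hT)

theorem IsSourceKnot.mem_of_reachable {S : Finset V} (hS : Γ.IsSourceKnot S) {u v : V}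
    (hv : v ∈ S) (h : Reachable Γ.arcs u v) : u ∈ S := by
  induction h using Relation.ReflTransGen.head_induction_on with
  | refl => exact hv
  | head h _ ih => exact hS.mem_of_arc ih h

/-- An ancestor of `v` with the least number of ancestors lies in a source knot. -/
theorem exists_isSourceKnot_reachable (Γ : WeightedDigraph V) (v : V) :
    ∃ S, Γ.IsSourceKnot S ∧ ∀ u ∈ S, Reachable Γ.arcs u v := by
  classical
  let anc : V → Finset V := fun x => Finset.univ.filter fun u => Reachable Γ.arcs u x
  obtain ⟨x, hx, hmin⟩ := (anc v).exists_min_image (fun x => (anc x).card)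
    ⟨v, Finset.mem_filter.2 ⟨Finset.mem_univ v, .refl⟩⟩
  have hxv : Reachable Γ.arcs x v := by simpa [anc] using hx
  have hback : ∀ u, Reachable Γ.arcs u x → Reachable Γ.arcs x u := by
    intro u hu
    have hsub : anc u ⊆ anc x := by
      intro z hz
      simp only [anc, Finset.mem_filter, Finset.mem_univ, true_and] at hz ⊢
      exact hz.trans hu
    have huv : u ∈ anc v := by
      simp only [anc, Finset.mem_filter, Finset.mem_univ, true_and]
      exact hu.trans hxv
    have heq := Finset.eq_of_subset_of_card_le hsub (hmin u huv)
    have hxx : x ∈ anc x := Finset.mem_filter.2 ⟨Finset.mem_univ x, .refl⟩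
    rw [← heq] at hxx
    simpa [anc] using hxx
  obtain ⟨S, hS, hxS⟩ := Γ.exists_isStrongComponent_mem x
  refine ⟨S, ⟨hS, ?_⟩, fun u hu => (hS.reachable hu hxS).trans hxv⟩
  rintro T hT ⟨hne, a, ha, b, hb, hab⟩
  have hax : Reachable Γ.arcs a x := .head hab (hS.reachable hb hxS)
  exact hne (hT.eq hS ha (hS.mem hxS hax (hback a hax)))

/-- Every forest has a root in every source knot, as it cannot be entered from outside. -/
theorem IsSourceKnot.exists_isSource_mem {S : Finset V} (hS : Γ.IsSourceKnot S)
    {F : Finset (V × V)} (hF : F ∈ Γ.outForests) : ∃ r ∈ S, IsSource F r := by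
  simp only [outForests, Finset.mem_filter, Finset.mem_powerset, isDivergingForest_iff] at hF
  obtain ⟨v, hv⟩ := hS.1.nonempty
  obtain ⟨r, hr, hrv⟩ := hF.2.2 v
  exact ⟨r, hS.mem_of_reachable hv (hrv.mono hF.1), hr⟩

theorem exists_numTrees_eq_outForestDim (Γ : WeightedDigraph V) :
    ∃ F ∈ Γ.outForests, numTrees F = Γ.outForestDim := by
  have h : {m | ∃ F ∈ Γ.outForests, numTrees F = m}.Nonempty := by
    refine ⟨_, ∅, ?_, rfl⟩
    simp only [outForests, Finset.mem_filter, Finset.mem_powerset, isDivergingForest_iff]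
    exact ⟨Finset.empty_subset _, fun a b v ha => absurd ha (Finset.notMem_empty _),
      fun v => ⟨v, fun a => Finset.notMem_empty _, .refl⟩⟩
  exact Nat.sInf_mem h

theorem card_add_numTrees_of_mem {F : Finset (V × V)} (hF : F ∈ Γ.outForests) :
    F.card + numTrees F = Fintype.card V := by
  simp only [outForests, Finset.mem_filter, isDivergingForest_iff] at hF
  exact card_add_numTrees hF.2.1

theorem card_le_card_sub_outForestDim :
    ∀ F ∈ Γ.outForests, F.card ≤ Fintype.card V - Γ.outForestDim := by
  intro F hF
  have h1 : Γ.outForestDim ≤ numTrees F := Nat.sInf_le ⟨F, hF, rfl⟩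
  have h2 := card_add_numTrees_of_mem hF
  omega

theorem sigma_card_sub_outForestDim_pos :
    0 < Γ.sigma (Fintype.card V - Γ.outForestDim) := by
  obtain ⟨F, hF, hd⟩ := Γ.exists_numTrees_eq_outForestDim
  have hc := card_add_numTrees_of_mem hF
  simp only [outForests, Finset.mem_filter, Finset.mem_powerset] at hF
  refine Γ.setWeight_pos ⟨F, ?_⟩ fun F hF => (Γ.mem_outForestsCard.1 hF).1
  exact Γ.mem_outForestsCard.2 ⟨hF.1, hF.2, by omega⟩

theorem Jtilde_apply (i j : V) : Γ.Jtilde i j =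
    (Γ.sigma (Fintype.card V - Γ.outForestDim))⁻¹ *
      Γ.Q (Fintype.card V - Γ.outForestDim) i j := rfl

theorem laplacian_mulVec_Jtilde (Γ : WeightedDigraph V) (j : V) :
    Matrix.mulVec Γ.laplacian (fun i => Γ.Jtilde i j) = 0 := by
  have h : (fun i => Γ.Jtilde i j) = (Γ.sigma (Fintype.card V - Γ.outForestDim))⁻¹ •
      fun i => Γ.Q (Fintype.card V - Γ.outForestDim) i j := rfl
  rw [h, Matrix.mulVec_smul, laplacian_mulVec_Q card_le_card_sub_outForestDim, smul_zero]

theorem sum_Jtilde (Γ : WeightedDigraph V) (j : V) : ∑ i, Γ.Jtilde i j = 1 := by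
  simp only [Jtilde_apply, ← Finset.mul_sum, sum_Q]
  exact inv_mul_cancel₀ sigma_card_sub_outForestDim_pos.ne'

theorem IsSourceKnot.Jtilde_eq_zero {S : Finset V} (hS : Γ.IsSourceKnot S) {i j : V}
    (hj : j ∈ S) (hi : i ∉ S) : Γ.Jtilde i j = 0 := by
  rw [Jtilde_apply, Q, setWeight, Finset.sum_eq_zero, mul_zero]
  intro F hF
  obtain ⟨hF, _, hij⟩ := Γ.mem_outForestsFromTo.1 hF
  exact absurd (hS.mem_of_reachable hj (hij.mono (Γ.mem_outForestsCard.1 hF).1)) hi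

variable {d : ℕ} {K : Fin d → Finset V}

theorem EnumeratesSourceKnots.isSourceKnot (hK : Γ.EnumeratesSourceKnots K) (s : Fin d) :
    Γ.IsSourceKnot (K s) := (hK.2 _).2 ⟨s, rfl⟩

theorem EnumeratesSourceKnots.eq_of_mem (hK : Γ.EnumeratesSourceKnots K) {s t : Fin d} {v : V}
    (hs : v ∈ K s) (ht : v ∈ K t) : s = t :=
  hK.1 ((hK.isSourceKnot s).1.eq (hK.isSourceKnot t).1 hs ht)

theorem EnumeratesSourceKnots.exists_reachable (hK : Γ.EnumeratesSourceKnots K)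
    {j : Fin d → V} (hj : ∀ s, j s ∈ K s) (v : V) : ∃ s, Reachable Γ.arcs (j s) v := by
  obtain ⟨S, hS, hv⟩ := Γ.exists_isSourceKnot_reachable v
  obtain ⟨s, rfl⟩ := (hK.2 S).1 hS
  exact ⟨s, hv _ (hj s)⟩

/-- The number of source knots is the out-forest dimension: every forest has a root in every
source knot, and some forest has only one root in each of them. -/
theorem EnumeratesSourceKnots.eq_outForestDim (hK : Γ.EnumeratesSourceKnots K) :
    d = Γ.outForestDim := by
  classical
  refine le_antisymm ?_ ?_
  · obtain ⟨F, hF, hd⟩ := Γ.exists_numTrees_eq_outForestDim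
    have hF' := hF
    simp only [outForests, Finset.mem_filter, isDivergingForest_iff] at hF'
    choose r hr hs using fun s => (hK.isSourceKnot s).exists_isSource_mem hF
    rw [← hd, numTrees_eq_card_isSource hF'.2.1, ← Fintype.card_fin d, ← Finset.card_univ]
    refine Finset.card_le_card_of_injOn r (fun s _ => by simpa using hs s) ?_
    intro s _ t _ hst
    exact hK.eq_of_mem (hr s) (hst ▸ hr t)
  · choose j hj using fun s => (hK.isSourceKnot s).1.nonempty
    obtain ⟨F, hFE, hU, hs, hr⟩ := exists_inUnique_of_reachable Γ.arcs (Set.range j) (by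
      intro v
      obtain ⟨s, hs⟩ := hK.exists_reachable hj v
      exact ⟨_, ⟨s, rfl⟩, hs⟩)
    have hF : F ∈ Γ.outForests := by
      simp only [outForests, Finset.mem_filter, Finset.mem_powerset, isDivergingForest_iff]
      refine ⟨hFE, hU, fun v => ?_⟩
      obtain ⟨r, hrR, hrv⟩ := hr v
      exact ⟨r, (hs r).2 hrR, hrv⟩
    have h1 : Γ.outForestDim ≤ numTrees F := Nat.sInf_le ⟨F, hF, rfl⟩
    refine h1.trans ?_
    rw [numTrees_eq_card_isSource hU]
    have h2 : (Finset.univ.filter fun r => IsSource F r) = Finset.univ.image j := by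
      ext r
      simp [hs]
    rw [h2]
    exact Finset.card_image_le.trans (by simp)

/-- Maximum principle: all ancestors of a vertex where `y` is maximal have the same value of `y`,
and there is a whole source knot among them. -/
theorem EnumeratesSourceKnots.nonpos_of_transpose_mulVec_eq_zero
    (hK : Γ.EnumeratesSourceKnots K) {j : Fin d → V} (hj : ∀ s, j s ∈ K s) {y : V → ℝ}
    (hy : Matrix.mulVec Γ.laplacian.transpose y = 0) (h0 : ∀ s, y (j s) = 0) (i : V) :
    y i ≤ 0 := by
  obtain ⟨v, _, hv⟩ := Finset.univ.exists_max_image y ⟨i, Finset.mem_univ i⟩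
  have hanc : ∀ u, Reachable Γ.arcs u v → y u = y v := by
    intro u hu
    induction hu using Relation.ReflTransGen.head_induction_on with
    | refl => rfl
    | @head a c hac _ ih =>
      have h := congrFun hy c
      rw [laplacian_transpose_mulVec, Pi.zero_apply, Finset.sum_eq_zero_iff_of_nonneg] at h
      · have ha := h a (Finset.mem_univ a)
        rw [mul_eq_zero, or_iff_right (Γ.mem_arcs.1 hac).ne'] at ha
        linarith
      · intro k hk
        exact mul_nonneg (Γ.nonneg _ _) (by rw [ih]; exact sub_nonneg.2 (hv k hk))
  obtain ⟨s, hs⟩ := hK.exists_reachable hj v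
  rw [← h0 s, hanc _ hs]
  exact hv i (Finset.mem_univ i)

/-- A solution of the transposed system is determined by its values at one vertex of each source
knot; the two systems have solution spaces of the same dimension. -/
theorem EnumeratesSourceKnots.finrank_ker_le (hK : Γ.EnumeratesSourceKnots K) :
    Module.finrank ℝ (LinearMap.ker (Matrix.mulVecLin Γ.laplacian)) ≤ d := by
  classical
  choose j hj using fun s => (hK.isSourceKnot s).1.nonempty
  have h1 : Module.finrank ℝ (LinearMap.ker (Matrix.mulVecLin Γ.laplacian)) =
      Module.finrank ℝ (LinearMap.ker (Matrix.mulVecLin Γ.laplacian.transpose)) := by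
    have ha := LinearMap.finrank_range_add_finrank_ker (Matrix.mulVecLin Γ.laplacian)
    have hb := LinearMap.finrank_range_add_finrank_ker (Matrix.mulVecLin Γ.laplacian.transpose)
    have hc := Matrix.rank_transpose Γ.laplacian
    rw [Matrix.rank, Matrix.rank] at hc
    omega
  rw [h1]
  let f : LinearMap.ker (Matrix.mulVecLin Γ.laplacian.transpose) →ₗ[ℝ] (Fin d → ℝ) :=
    (LinearMap.funLeft ℝ ℝ j).comp (Submodule.subtype _)
  have hf : Function.Injective f := by
    rw [injective_iff_map_eq_zero]
    rintro ⟨y, hy⟩ h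
    rw [LinearMap.mem_ker, Matrix.mulVecLin_apply] at hy
    have h0 : ∀ s, y (j s) = 0 := fun s => congrFun h s
    refine Subtype.ext (funext fun i => le_antisymm ?_ ?_)
    · exact hK.nonpos_of_transpose_mulVec_eq_zero hj hy h0 i
    · have := hK.nonpos_of_transpose_mulVec_eq_zero hj (y := -y)
        (by rw [Matrix.mulVec_neg, hy, neg_zero]) (by simp [h0]) i
      simpa using this
  simpa using LinearMap.finrank_le_finrank_of_injective hf

theorem EnumeratesSourceKnots.sum_Jtilde_eq_ite (hK : Γ.EnumeratesSourceKnots K)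
    {s t : Fin d} {j : V} (hj : j ∈ K s) :
    ∑ i ∈ K t, Γ.Jtilde i j = if s = t then 1 else 0 := by
  split_ifs with h
  · subst h
    rw [← Γ.sum_Jtilde j]
    exact Finset.sum_subset (Finset.subset_univ _)
      fun i _ hi => (hK.isSourceKnot s).Jtilde_eq_zero hj hi
  · refine Finset.sum_eq_zero fun i hi => (hK.isSourceKnot s).Jtilde_eq_zero hj fun hi' => ?_
    exact h (hK.eq_of_mem hi' hi)

theorem EnumeratesSourceKnots.exists_basis (hK : Γ.EnumeratesSourceKnots K) {j : Fin d → V}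
    (hj : ∀ s, j s ∈ K s) :
    ∃ b : Module.Basis (Fin d) ℝ (LinearMap.ker (Matrix.mulVecLin Γ.laplacian)),
      ∀ s, ((b s : LinearMap.ker (Matrix.mulVecLin Γ.laplacian)) : V → ℝ) =
        fun i => Γ.Jtilde i (j s) := by
  let c : Fin d → LinearMap.ker (Matrix.mulVecLin Γ.laplacian) := fun s =>
    ⟨fun i => Γ.Jtilde i (j s), Γ.laplacian_mulVec_Jtilde (j s)⟩
  have hli : LinearIndependent ℝ c := by
    rw [Fintype.linearIndependent_iff]
    intro g hg t
    have h1 : ∀ i, ∑ s, g s * Γ.Jtilde i (j s) = 0 := by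
      intro i
      simpa [c] using congrFun (congrArg Subtype.val hg) i
    have h2 : ∑ i ∈ K t, ∑ s, g s * Γ.Jtilde i (j s) = g t := by
      rw [Finset.sum_comm]
      simp [← Finset.mul_sum, hK.sum_Jtilde_eq_ite (hj _)]
    rw [← h2]
    exact Finset.sum_eq_zero fun i _ => h1 i
  have hcard : Fintype.card (Fin d) =
      Module.finrank ℝ (LinearMap.ker (Matrix.mulVecLin Γ.laplacian)) :=
    le_antisymm hli.fintype_card_le_finrank (by simpa using hK.finrank_ker_le)
  refine ⟨Module.Basis.mk hli (hli.span_eq_top_of_card_eq_finrank' hcard).ge, fun s => ?_⟩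
  rw [Module.Basis.mk_apply]

/-- A solution of `L x = 0` is determined by its sums over the source knots. -/
theorem EnumeratesSourceKnots.eq_Jtilde (hK : Γ.EnumeratesSourceKnots K) {s : Fin d} {j : V}
    (hj : j ∈ K s) {x : V → ℝ} (hx : Matrix.mulVec Γ.laplacian x = 0)
    (hsum : ∀ t, ∑ i ∈ K t, x i = if s = t then 1 else 0) (i : V) : x i = Γ.Jtilde i j := by
  choose l hl using fun s => (hK.isSourceKnot s).1.nonempty
  have hl' : ∀ t, Function.update l s j t ∈ K t := by
    intro t
    by_cases h : t = s
    · subst h; simpa using hj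
    · simpa [h] using hl t
  obtain ⟨b, hb⟩ := hK.exists_basis hl'
  have h1 : ∀ i, x i = ∑ t, b.repr ⟨x, hx⟩ t * Γ.Jtilde i (Function.update l s j t) := by
    intro i
    have h := congrFun (congrArg Subtype.val (b.sum_repr ⟨x, hx⟩)) i
    simp only [Submodule.coe_sum, Submodule.coe_smul, Finset.sum_apply, Pi.smul_apply, hb,
      smul_eq_mul] at h
    exact h.symm
  have h2 : ∀ t, b.repr ⟨x, hx⟩ t = if s = t then 1 else 0 := by
    intro t
    rw [← hsum t]
    simp only [h1]
    rw [Finset.sum_comm]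
    simp [← Finset.mul_sum, hK.sum_Jtilde_eq_ite (hl' _)]
  rw [h1]
  simp [h2]

end Knots

/-! ### Out-arborescences of a source knot -/

section Arborescences

variable {V : Type*} [Fintype V] {Γ : WeightedDigraph V}

theorem outForestsFromTo_card_sub_one (r j : V) :
    Γ.outForestsFromTo (Fintype.card V - 1) r j = Γ.arborescencesFrom r := by
  classical
  ext F
  have hpos : 0 < Fintype.card V := Fintype.card_pos_iff.2 ⟨r⟩
  simp only [mem_outForestsFromTo, mem_outForestsCard, arborescencesFrom, Finset.mem_filter,
    Finset.mem_powerset, isDivergingForest_iff, isDivergingTree_iff]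
  constructor
  · rintro ⟨⟨hs, ⟨hU, hR⟩, hc⟩, hr, hj⟩
    refine ⟨hs, hU, hr, fun v => ?_⟩
    obtain ⟨q, hq, hqv⟩ := hR v
    have h1 := card_add_numTrees hU
    rw [numTrees_eq_card_isSource hU] at h1
    have h2 : (Finset.univ.filter fun r => IsSource F r).card ≤ 1 := by omega
    rw [Finset.card_le_one] at h2
    rwa [h2 r (by simpa using hr) q (by simpa using hq)]
  · rintro ⟨hs, hU, hr, hR⟩
    refine ⟨⟨hs, ⟨hU, fun v => ⟨r, hr, hR v⟩⟩, ?_⟩, hr, hR j⟩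
    have h1 := card_add_numTrees hU
    have h2 : (Finset.univ.filter fun r => IsSource F r) = {r} := by
      ext q
      simp only [Finset.mem_filter, Finset.mem_univ, true_and, Finset.mem_singleton]
      exact ⟨fun hq => ((hR q).eq_of_isSource hq).symm, fun hq => hq ▸ hr⟩
    rw [numTrees_eq_card_isSource hU, h2, Finset.card_singleton] at h1
    omega

theorem outForestsCard_card_sub_one [Nonempty V] :
    Γ.outForestsCard (Fintype.card V - 1) = Γ.arborescences := by
  classical
  ext F
  obtain ⟨j⟩ := ‹Nonempty V›
  have h : ∀ r, F ∈ Γ.outForestsFromTo (Fintype.card V - 1) r j ↔ F ∈ Γ.arborescencesFrom r :=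
    fun r => by rw [outForestsFromTo_card_sub_one]
  simp only [arborescences, Finset.mem_filter, arborescencesFrom, mem_outForestsFromTo] at h ⊢
  constructor
  · intro hF
    obtain ⟨r, hr⟩ := (isDivergingForest_iff.1 (Γ.mem_outForestsCard.1 hF).2.1).2 j
    exact ⟨((h r).1 ⟨hF, hr⟩).1, r, ((h r).1 ⟨hF, hr⟩).2⟩
  · rintro ⟨hF, r, hr⟩
    exact ((h r).2 ⟨hF, hr⟩).1

theorem Q_card_sub_one (i j : V) :
    Γ.Q (Fintype.card V - 1) i j = Γ.setWeight (Γ.arborescencesFrom i) := by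
  rw [Q, outForestsFromTo_card_sub_one]

theorem sum_arborescencesFrom [Nonempty V] :
    ∑ i, Γ.setWeight (Γ.arborescencesFrom i) = Γ.setWeight Γ.arborescences := by
  obtain ⟨j⟩ := ‹Nonempty V›
  have h := Γ.sum_Q (Fintype.card V - 1) j
  simp only [Q_card_sub_one, sigma] at h
  have : Nonempty V := ⟨j⟩
  rw [h, outForestsCard_card_sub_one]

/-- The vector of tree weights solves `L x = 0`: an out-forest with `card V - 1` arcs is an
out-arborescence, and no out-forest has more arcs. -/
theorem laplacian_mulVec_arborescencesFrom :
    Matrix.mulVec Γ.laplacian (fun i => Γ.setWeight (Γ.arborescencesFrom i)) = 0 := by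
  rcases isEmpty_or_nonempty V with _ | ⟨⟨j⟩⟩
  · exact Subsingleton.elim _ _
  have hk : ∀ F ∈ Γ.outForests, F.card ≤ Fintype.card V - 1 := by
    intro F hF
    have h1 := card_add_numTrees_of_mem hF
    simp only [outForests, Finset.mem_filter, isDivergingForest_iff] at hF
    obtain ⟨r, hr, -⟩ := hF.2.2 j
    have h2 : 0 < numTrees F := by
      rw [numTrees_eq_card_isSource hF.2.1]
      exact Finset.card_pos.2 ⟨r, by simpa using hr⟩
    omega
  simpa only [Q_card_sub_one] using laplacian_mulVec_Q hk j

theorem setWeight_arborescences_pos {r : V} (h : ∀ v, Reachable Γ.arcs r v) :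
    0 < Γ.setWeight Γ.arborescences := by
  refine Γ.setWeight_pos ?_ fun F hF => by
    simp only [arborescences, Finset.mem_filter, Finset.mem_powerset] at hF
    exact hF.1
  obtain ⟨F, hFE, hU, hs, hr⟩ := exists_inUnique_of_reachable Γ.arcs {r} (by simpa using h)
  refine ⟨F, ?_⟩
  simp only [arborescences, Finset.mem_filter, Finset.mem_powerset]
  exact ⟨hFE, r, isDivergingTree_iff.2 ⟨hU, (hs r).2 rfl, by simpa using hr⟩⟩

open Classical in
/-- If no arc enters `S`, then solutions of the system of the restriction to `S` extend by zero. -/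
theorem laplacian_mulVec_extend {S : Finset V} (hS : ∀ u v, v ∈ S → (u, v) ∈ Γ.arcs → u ∈ S)
    {y : {x // x ∈ S} → ℝ} (hy : Matrix.mulVec (Γ.restrict S).laplacian y = 0) :
    Matrix.mulVec Γ.laplacian (fun i => if hi : i ∈ S then y ⟨i, hi⟩ else 0) = 0 := by
  have hw : ∀ u v, v ∈ S → u ∉ S → Γ.w u v = 0 := fun u v hv hu =>
    Γ.w_eq_zero_of_notMem (mt (hS u v hv) hu)
  have hsum : ∀ f : V → ℝ, (∀ k ∉ S, f k = 0) → ∑ k, f k = ∑ k : {x // x ∈ S}, f k := by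
    intro f hf
    rw [Finset.sum_coe_sort S f]
    exact (Finset.sum_subset (Finset.subset_univ _) fun k _ hk => hf k hk).symm
  funext i
  rw [laplacian_mulVec, Pi.zero_apply]
  by_cases hi : i ∈ S
  · have h := congrFun hy ⟨i, hi⟩
    rw [laplacian_mulVec, Pi.zero_apply] at h
    rw [hsum (fun k => Γ.w k i) fun k hk => hw k i hi hk,
      hsum _ fun k hk => by rw [dif_neg hk, mul_zero]]
    simpa [hi, restrict] using h
  · rw [dif_neg hi, mul_zero, zero_sub, neg_eq_zero]
    refine Finset.sum_eq_zero fun k _ => ?_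
    by_cases hk : k ∈ S
    · rw [hw i k hk hi, zero_mul]
    · rw [dif_neg hk, mul_zero]

theorem IsSourceKnot.reachable_restrict {S : Finset V} (hS : Γ.IsSourceKnot S)
    (u v : {x // x ∈ S}) : Reachable (Γ.restrict S).arcs u v := by
  obtain ⟨u, hu⟩ := u
  obtain ⟨v, hv⟩ := v
  have h := hS.1.reachable hu hv
  induction h with
  | refl => exact .refl
  | @tail a b _ hab ih =>
    refine (ih (hS.mem_of_arc hv hab)).tail ?_
    rw [mem_arcs] at hab ⊢
    exact hab

theorem IsSourceKnot.setWeight_arborescences_restrict_pos {S : Finset V}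
    (hS : Γ.IsSourceKnot S) : 0 < (Γ.restrict S).setWeight (Γ.restrict S).arborescences := by
  obtain ⟨v, hv⟩ := hS.1.nonempty
  exact setWeight_arborescences_pos (hS.reachable_restrict ⟨v, hv⟩)

/-- The normalized vector of tree weights of a source knot solves `L x = 0` and has the same sums
over the source knots as a column of the matrix of maximum out-forests. -/
theorem EnumeratesSourceKnots.Jtilde_eq_arborescencesFrom {d : ℕ} {K : Fin d → Finset V}
    (hK : Γ.EnumeratesSourceKnots K) {s : Fin d} {i j : V} (hj : j ∈ K s) (hi : i ∈ K s) :
    Γ.Jtilde i j = ((Γ.restrict (K s)).setWeight (Γ.restrict (K s)).arborescences)⁻¹ *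
      (Γ.restrict (K s)).setWeight ((Γ.restrict (K s)).arborescencesFrom ⟨i, hi⟩) := by
  classical
  have hS := hK.isSourceKnot s
  set Z := (Γ.restrict (K s)).setWeight (Γ.restrict (K s)).arborescences with hZ
  have hZpos : 0 < Z := hS.setWeight_arborescences_restrict_pos
  let y : {x // x ∈ K s} → ℝ :=
    Z⁻¹ • fun k => (Γ.restrict (K s)).setWeight ((Γ.restrict (K s)).arborescencesFrom k)
  have hy : Matrix.mulVec (Γ.restrict (K s)).laplacian y = 0 := by
    rw [Matrix.mulVec_smul, laplacian_mulVec_arborescencesFrom, smul_zero]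
  have hx := laplacian_mulVec_extend (fun _ _ hv h => hS.mem_of_arc hv h) hy
  have key := hK.eq_Jtilde hj hx (fun t => ?_) i
  · rw [← key, dif_pos hi]
    rfl
  · split_ifs with h
    · subst h
      have : Nonempty {x // x ∈ K s} := ⟨⟨j, hj⟩⟩
      rw [← Finset.sum_coe_sort]
      simp only [Finset.coe_mem, dite_true, Subtype.coe_eta, y, Pi.smul_apply, smul_eq_mul,
        ← Finset.mul_sum]
      rw [sum_arborescencesFrom, ← hZ, inv_mul_cancel₀ hZpos.ne']
    · exact Finset.sum_eq_zero fun k hk => dif_neg fun hk' => h (hK.eq_of_mem hk' hk)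

end Arborescences

end WeightedDigraph

/-! ### Standard numberings -/

/-- In a standard numbering, the vertices of each set of the list are consecutive. -/
theorem IsStandardNumbering.exists_interval {n d : ℕ} {K : Fin d → Finset (Fin n)}
    (hK : IsStandardNumbering K) (s : Fin d) (hs : (K s).Nonempty) :
    ∃ a k : ℕ, a + k ≤ n ∧ ∀ v : Fin n, v ∈ K s ↔ a ≤ (v : ℕ) ∧ (v : ℕ) < a + k := by
  have hab : (((K s).min' hs : Fin n) : ℕ) ≤ ((K s).max' hs : Fin n) :=
    Fin.le_def.1 ((K s).min'_le_max' hs)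
  have hmax := ((K s).max' hs).isLt
  refine ⟨(K s).min' hs, ((K s).max' hs : ℕ) + 1 - (K s).min' hs, by omega, fun v => ?_⟩
  constructor
  · intro hv
    have h1 := Fin.le_def.1 ((K s).min'_le v hv)
    have h2 := Fin.le_def.1 ((K s).le_max' v hv)
    omega
  · rintro ⟨h1, h2⟩
    by_contra hv
    have h3 : v ≤ (K s).max' hs := Fin.le_def.2 (by omega)
    by_cases h : ∃ t, v ∈ K t
    · obtain ⟨t, ht⟩ := h
      rcases lt_trichotomy s t with hst | rfl | hst
      · exact absurd (hK.1 s t hst _ ((K s).max'_mem hs) v ht) (not_lt.2 h3)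
      · exact hv ht
      · exact absurd (hK.1 t s hst v ht _ ((K s).min'_mem hs)) (not_lt.2 (Fin.le_def.2 h1))
    · exact absurd (hK.2 s _ ((K s).max'_mem hs) v (not_exists.1 h)) (not_lt.2 h3)

theorem theorem6 (n : ℕ) (hn : 1 < n) (Γ : WeightedDigraph (Fin n)) :
    (∀ j : Fin n, Matrix.mulVec Γ.laplacian (fun i => Γ.Jtilde i j) = 0) ∧
    ∀ (d : ℕ) (K : Fin d → Finset (Fin n)), Γ.EnumeratesSourceKnots K → IsStandardNumbering K →
      ∀ j : Fin d → Fin n, (∀ s, j s ∈ K s) →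
        d = Γ.outForestDim ∧
        (∃ b : Module.Basis (Fin d) ℝ (LinearMap.ker (Matrix.mulVecLin Γ.laplacian)),
          (∀ s, ((b s : LinearMap.ker (Matrix.mulVecLin Γ.laplacian)) : Fin n → ℝ) =
            fun i => Γ.Jtilde i (j s)) ∧
          ∀ s t, s ≠ t →
            dotProduct (fun i => Γ.Jtilde i (j s)) (fun i => Γ.Jtilde i (j t)) = 0) ∧
        ∀ s : Fin d,
          (∃ a k : ℕ, a + k ≤ n ∧ ∀ v : Fin n, v ∈ K s ↔ a ≤ (v : ℕ) ∧ (v : ℕ) < a + k) ∧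
          0 < (Γ.restrict (K s)).setWeight (Γ.restrict (K s)).arborescences ∧
          (∀ (i : Fin n) (hi : i ∈ K s),
            Γ.Jtilde i (j s) =
              ((Γ.restrict (K s)).setWeight (Γ.restrict (K s)).arborescences)⁻¹ *
                (Γ.restrict (K s)).setWeight ((Γ.restrict (K s)).arborescencesFrom ⟨i, hi⟩)) ∧
          ∀ i : Fin n, i ∉ K s → Γ.Jtilde i (j s) = 0 := by
  refine ⟨Γ.laplacian_mulVec_Jtilde, fun d K hK hnum j hj => ⟨hK.eq_outForestDim, ?_, fun s => ?_⟩⟩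
  · obtain ⟨b, hb⟩ := hK.exists_basis hj
    refine ⟨b, hb, fun s t hst => Finset.sum_eq_zero fun i _ => ?_⟩
    by_cases hi : i ∈ K s
    · have hit : i ∉ K t := fun h => hst (hK.eq_of_mem hi h)
      simp only [(hK.isSourceKnot t).Jtilde_eq_zero (hj t) hit, mul_zero]
    · simp only [(hK.isSourceKnot s).Jtilde_eq_zero (hj s) hi, zero_mul]
  · have hS := hK.isSourceKnot s
    exact ⟨hnum.exists_interval s hS.1.nonempty, hS.setWeight_arborescences_restrict_pos,
      fun i hi => hK.Jtilde_eq_arborescencesFrom (hj s) hi,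
      fun i hi => hS.Jtilde_eq_zero (hj s) hi⟩
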